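/- Let $d$ be a norm-derived metric on $\mathbb{R}^2$, that is, $d(x,y)=\|x-y\|$ for some norm $\|\cdot\|$ on $\mathbb{R}^2$, and let $P=\{x\in\mathbb{R}^2 : d(x,0)\le 1\}$ be its unit ball. Suppose that either $P$ is a polygon, or the boundary of $P$ is a smooth curve (a simple closed curve with a continuously differentiable parametrization whose derivative never vanishes). Then $d$ has the truncating property if and only if $d$ is not a box metric, i.e. if and only if $P$ is not a parallelogram. Here $d$ is said to have the truncating property if for every countable dense set $V\subseteq\mathbb{R}^2$, every map $f:V\to V$ with $\lfloor d(u,v)\rfloor=\lfloor d(f(u),f(v))\rfloor$ for all $u,v\in V$ (a step-isometry) satisfies $d(f(u),f(v))=d(u,v)$ for all $u,v\in V$ (is an isometry). -/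

import Mathlib

/-- The plane `ℝ²`, with its usual topology. -/
abbrev Plane : Type := EuclideanSpace ℝ (Fin 2)

/-- `d` is a norm-derived metric: `d(x, y) = ‖x - y‖` for some norm on the plane
(a norm is a seminorm that vanishes only at the origin). -/
def IsNormDerived (d : Plane → Plane → ℝ) : Prop :=
  ∃ N : Seminorm ℝ Plane, (∀ x, N x = 0 → x = 0) ∧ ∀ x y, d x y = N (x - y)

/-- The shape of `d`: its closed unit ball around the origin. -/
def shape (d : Plane → Plane → ℝ) : Set Plane :=
  {x | d x 0 ≤ 1}

/-- A (convex, filled) polygon, possibly degenerate: the convex hull of finitely many points. -/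
def IsConvexPolygon (S : Set Plane) : Prop :=
  ∃ F : Finset Plane, S = convexHull ℝ (F : Set Plane)

/-- `C` is a smooth simple closed curve: it is traced by a 1-periodic, continuously differentiable
parametrization with nowhere vanishing derivative, which is injective on one period. -/
def IsSmoothClosedCurve (C : Set Plane) : Prop :=
  ∃ γ : ℝ → Plane, ContDiff ℝ 1 γ ∧ (∀ t, deriv γ t ≠ 0) ∧ Function.Periodic γ 1 ∧
    Set.InjOn γ (Set.Ico 0 1) ∧ Set.range γ = C

/-- A (filled, nondegenerate) parallelogram: a translate of the set of all `s • u + t • v` with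
`s, t ∈ [0, 1]`, where `u` and `v` are linearly independent. -/
def IsParallelogram (S : Set Plane) : Prop :=
  ∃ c u v : Plane, LinearIndependent ℝ ![u, v] ∧
    S = (fun x => c + x) '' parallelepiped ![u, v]

/-- A polygonal metric: the shape is a polygon. -/
def IsPolygonalMetric (d : Plane → Plane → ℝ) : Prop :=
  IsNormDerived d ∧ IsConvexPolygon (shape d)

/-- A smooth metric: the shape is bounded by a smooth curve. -/
def IsSmoothMetric (d : Plane → Plane → ℝ) : Prop :=
  IsNormDerived d ∧ IsSmoothClosedCurve (frontier (shape d))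

/-- The class `Ω` of all norm-derived metrics that are polygonal or smooth. -/
def Omega : Set (Plane → Plane → ℝ) :=
  {d | IsPolygonalMetric d ∨ IsSmoothMetric d}

/-- A box metric: the shape is a parallelogram. -/
def IsBoxMetric (d : Plane → Plane → ℝ) : Prop :=
  IsNormDerived d ∧ IsParallelogram (shape d)

/-- A step-isometry `V → V` preserves distances rounded down to integers. -/
def IsStepIsometry (d : Plane → Plane → ℝ) {V : Set Plane} (f : V → V) : Prop :=
  ∀ u v : V, ⌊d u v⌋ = ⌊d (f u) (f v)⌋

/-- `f : V → V` is an isometry for `d`: it preserves distances. -/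
def IsMetricIsometry (d : Plane → Plane → ℝ) {V : Set Plane} (f : V → V) : Prop :=
  ∀ u v : V, d (f u) (f v) = d u v

/-- The truncating property: on every countable dense subset of the plane, every step-isometry
is an isometry. -/
def HasTruncatingProperty (d : Plane → Plane → ℝ) : Prop :=
  ∀ V : Set Plane, V.Countable → Dense V →
    ∀ f : V → V, IsStepIsometry d f → IsMetricIsometry d f

/-!
The statement holds for every norm on the plane; polygonality or smoothness of the unit ball plays
no role beyond the fact that the metric comes from a norm.

A step-isometry `f` of a dense set changes distances by less than `1`. Rescaling it along a free
ultrafilter gives an isometry of the plane fixing the origin, which is onto by compactness and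
linear by the Mazur-Ulam theorem (`exists_linearIsometryEquiv_asymptotic`). After composing with
its inverse, `f` preserves the direction of points that go to infinity.

Let `l` be the derivative of the norm at a point `z`. Balls with integer radii centred far away in
the direction of `-z` look locally like half-planes bounded by level lines of `l`, and `f` respects
such balls. Hence `f` respects integer thresholds of `l`: if `l v - l u > m` then
`l (f v) - l (f u) ≥ m` (`le_fderiv_norm_of_step`). In particular `f` induces a monotone function in
the coordinate `l`. With three pairwise non-proportional such functionals, the linear relation
between them turns into Pexider's equation for three monotone functions, so these are affine; the
integer thresholds force slope one, and `f` is a translation up to the linear isometry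
(`sub_eq_of_integer_thresholds`).

Since a norm is differentiable at a dense set of points, it is the maximum of its derivatives. If
there are no three non-proportional ones, it is the maximum of the absolute values of at most two
functionals (`norm_eq_max_or_exists_three_fderiv`), and its unit ball is a parallelogram
(`isParallelogram_iff_exists_linearEquiv`).

For a parallelogram, in coordinates that make the norm the maximum norm, the map that applies
`x ↦ ⌊x⌋ + (fract x)²` to both coordinates of the rational points preserves integer parts of
distances but not distances.
-/

open Filter Topology

/-! ### Isometries of finite-dimensional spaces and almost isometries -/

/-- An isometry of a finite-dimensional normed space into itself that fixes the origin is onto: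
the orbit of a point outside the image of a ball would be a uniformly separated sequence in that
ball, against compactness. -/
theorem Isometry.surjective_of_map_zero {E : Type*} [NormedAddCommGroup E] [NormedSpace ℝ E]
    [FiniteDimensional ℝ E] {U : E → E} (hU : Isometry U) (h0 : U 0 = 0) :
    Function.Surjective U := by
  intro y
  by_contra hy
  have hnorm : ∀ x, ‖U x‖ = ‖x‖ := fun x => by
    have := hU.dist_eq x 0
    simpa [h0] using this
  have : ProperSpace E := FiniteDimensional.proper ℝ E
  have hball : ∀ n, U^[n] y ∈ Metric.closedBall (0 : E) ‖y‖ := by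
    intro n
    induction n with
    | zero => simp
    | succ k ih =>
      rw [Function.iterate_succ_apply']
      simpa [hnorm] using ih
  have hcl : IsClosed (Set.range U) := hU.isClosedEmbedding.isClosed_range
  obtain ⟨ε, hε, hsep⟩ := Metric.isOpen_iff.1 hcl.isOpen_compl y (by simpa using hy)
  have hiter : ∀ (m : ℕ) (x y : E), dist (U^[m] x) (U^[m] y) = dist x y := by
    intro m
    induction m with
    | zero => simp
    | succ k ih => intro x y; rw [Function.iterate_succ_apply, Function.iterate_succ_apply, ih,
        hU.dist_eq]
  have hsep' : ∀ m n, m < n → ε ≤ dist (U^[n] y) (U^[m] y) := by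
    intro m n hmn
    obtain ⟨k, rfl⟩ := Nat.exists_eq_add_of_lt hmn
    have h1 : U^[m + k + 1] y = U^[m] (U (U^[k] y)) := by
      rw [← Function.iterate_succ_apply' U k, ← Function.iterate_add_apply]; rfl
    rw [h1, hiter]
    by_contra hlt
    exact hsep (Metric.mem_ball.2 (not_le.1 hlt)) ⟨_, rfl⟩
  obtain ⟨a, -, φ, hφ, ha⟩ := (isCompact_closedBall (0 : E) ‖y‖).tendsto_subseq hball
  obtain ⟨N, hN⟩ := Metric.cauchySeq_iff.1 ha.cauchySeq ε hε
  have := hN (N + 1) (by simp) N le_rfl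
  exact absurd this (not_lt.2 (hsep' _ _ (hφ (Nat.lt_succ_self N))))

theorem tendsto_inv_natCast_smul {E : Type*} [NormedAddCommGroup E] [NormedSpace ℝ E]
    {x : ℕ → E} {z : E} {C : ℝ} (h : ∀ n, ‖x n - (n : ℝ) • z‖ ≤ C) :
    Tendsto (fun n : ℕ => (n : ℝ)⁻¹ • x n) atTop (𝓝 z) := by
  rw [tendsto_iff_norm_sub_tendsto_zero]
  have h0 : Tendsto (fun n : ℕ => (n : ℝ)⁻¹ * C) atTop (𝓝 0) := by
    simpa using (tendsto_inv_atTop_nhds_zero_nat (𝕜 := ℝ)).mul_const C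
  refine squeeze_zero' (Eventually.of_forall fun n => norm_nonneg _) ?_ h0
  filter_upwards [eventually_gt_atTop 0] with n hn
  have hn' : (n : ℝ) ≠ 0 := by positivity
  have : (n : ℝ)⁻¹ • x n - z = (n : ℝ)⁻¹ • (x n - (n : ℝ) • z) := by
    rw [smul_sub, smul_smul, inv_mul_cancel₀ hn', one_smul]
  rw [this, norm_smul, norm_inv, RCLike.norm_natCast]
  gcongr
  exact h n

theorem hyperfilter_nat_le_atTop : (hyperfilter ℕ : Filter ℕ) ≤ atTop := by
  rw [← Nat.cofinite_eq_atTop]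
  exact hyperfilter_le_cofinite

/-- A map of a dense family in a finite-dimensional space that changes distances by at most `1`
looks like a linear isometry from far away. The limits are taken along a free ultrafilter, which
provides them without any choice of subsequences. -/
theorem exists_linearIsometryEquiv_asymptotic {ι E : Type*} [NormedAddCommGroup E]
    [NormedSpace ℝ E] [FiniteDimensional ℝ E] {p q : ι → E} (hp : DenseRange p)
    (hpq : ∀ i j, |‖q i - q j‖ - ‖p i - p j‖| ≤ 1) :
    ∃ U : E ≃ₗᵢ[ℝ] E, ∀ (w : ℕ → ι) (x : E),
      Tendsto (fun n : ℕ => (n : ℝ)⁻¹ • p (w n)) (hyperfilter ℕ) (𝓝 x) →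
      Tendsto (fun n : ℕ => (n : ℝ)⁻¹ • q (w n)) (hyperfilter ℕ) (𝓝 (U x)) := by
  have : ProperSpace E := FiniteDimensional.proper ℝ E
  have hinv : Tendsto (fun n : ℕ => (n : ℝ)⁻¹) (hyperfilter ℕ) (𝓝 0) :=
    (tendsto_inv_atTop_nhds_zero_nat (𝕜 := ℝ)).mono_left hyperfilter_nat_le_atTop
  have hscale : ∀ (v w : ℕ → ι) (n : ℕ),
      |‖(n : ℝ)⁻¹ • q (v n) - (n : ℝ)⁻¹ • q (w n)‖ - ‖(n : ℝ)⁻¹ • p (v n) - (n : ℝ)⁻¹ • p (w n)‖|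
        ≤ (n : ℝ)⁻¹ := by
    intro v w n
    have hn : (0 : ℝ) ≤ (n : ℝ)⁻¹ := by positivity
    rw [← smul_sub, ← smul_sub, norm_smul, norm_smul, Real.norm_of_nonneg hn, ← mul_sub, abs_mul,
      abs_of_nonneg hn]
    exact mul_le_of_le_one_right hn (hpq _ _)
  have hdist : ∀ (v w : ℕ → ι) (x y x' y' : E),
      Tendsto (fun n : ℕ => (n : ℝ)⁻¹ • p (v n)) (hyperfilter ℕ) (𝓝 x) →
      Tendsto (fun n : ℕ => (n : ℝ)⁻¹ • p (w n)) (hyperfilter ℕ) (𝓝 y) →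
      Tendsto (fun n : ℕ => (n : ℝ)⁻¹ • q (v n)) (hyperfilter ℕ) (𝓝 x') →
      Tendsto (fun n : ℕ => (n : ℝ)⁻¹ • q (w n)) (hyperfilter ℕ) (𝓝 y') →
      dist x' y' = dist x y := by
    intro v w x y x' y' h1 h2 h3 h4
    have h5 := (((h3.sub h4).norm).sub ((h1.sub h2).norm)).abs
    have h6 := squeeze_zero (fun n => abs_nonneg _) (hscale v w) hinv
    have h7 := tendsto_nhds_unique h5 h6
    rw [dist_eq_norm, dist_eq_norm]
    exact sub_eq_zero.1 (abs_eq_zero.1 h7)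
  have hw : ∀ (x : E) (n : ℕ), ∃ i, ‖p i - (n : ℝ) • x‖ ≤ 1 := by
    intro x n
    obtain ⟨i, hi⟩ := hp.exists_dist_lt ((n : ℝ) • x) one_pos
    rw [dist_comm, dist_eq_norm] at hi
    exact ⟨i, hi.le⟩
  choose w hw using hw
  have hwlim : ∀ x, Tendsto (fun n : ℕ => (n : ℝ)⁻¹ • p (w x n)) (hyperfilter ℕ) (𝓝 x) :=
    fun x => (tendsto_inv_natCast_smul (hw x)).mono_left hyperfilter_nat_le_atTop
  have hclose : ∀ (v w : ℕ → ι) (x y : E),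
      Tendsto (fun n : ℕ => (n : ℝ)⁻¹ • p (v n)) (hyperfilter ℕ) (𝓝 x) →
      Tendsto (fun n : ℕ => (n : ℝ)⁻¹ • p (w n)) (hyperfilter ℕ) (𝓝 x) →
      Tendsto (fun n : ℕ => (n : ℝ)⁻¹ • q (w n)) (hyperfilter ℕ) (𝓝 y) →
      Tendsto (fun n : ℕ => (n : ℝ)⁻¹ • q (v n)) (hyperfilter ℕ) (𝓝 y) := by
    intro v w x y h1 h2 h3
    have h4 : Tendsto (fun n : ℕ => ‖(n : ℝ)⁻¹ • p (v n) - (n : ℝ)⁻¹ • p (w n)‖ + (n : ℝ)⁻¹)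
        (hyperfilter ℕ) (𝓝 0) := by
      simpa using ((h1.sub h2).norm).add hinv
    have h5 : Tendsto (fun n : ℕ => (n : ℝ)⁻¹ • q (v n) - (n : ℝ)⁻¹ • q (w n))
        (hyperfilter ℕ) (𝓝 0) := by
      refine squeeze_zero_norm (fun n => ?_) h4
      have := (abs_le.1 (hscale v w n)).2
      linarith
    simpa using h5.add h3
  have hlim : ∀ x, ∃ y, Tendsto (fun n : ℕ => (n : ℝ)⁻¹ • q (w x n)) (hyperfilter ℕ) (𝓝 y) := by
    intro x
    let i₀ := w x 0
    have hbdd : ∀ᶠ n : ℕ in (hyperfilter ℕ : Filter ℕ),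
        (n : ℝ)⁻¹ • q (w x n) ∈ Metric.closedBall (0 : E) (‖x‖ + 3) := by
      have e1 := (hwlim x).norm.eventually (gt_mem_nhds (lt_add_one ‖x‖))
      have e2 : Tendsto (fun n : ℕ => ‖(n : ℝ)⁻¹ • p i₀‖ + (n : ℝ)⁻¹ + ‖(n : ℝ)⁻¹ • q i₀‖)
          (hyperfilter ℕ) (𝓝 0) := by
        simpa using (((hinv.smul_const (p i₀)).norm).add hinv).add (hinv.smul_const (q i₀)).norm
      filter_upwards [e1, e2.eventually (gt_mem_nhds (one_pos))] with n h1 h2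
      have h3 := (abs_le.1 (hscale (w x) (fun _ => i₀) n)).2
      have h4 := norm_sub_le ((n : ℝ)⁻¹ • p (w x n)) ((n : ℝ)⁻¹ • p i₀)
      have h5 := norm_sub_norm_le ((n : ℝ)⁻¹ • q (w x n)) ((n : ℝ)⁻¹ • q i₀)
      rw [mem_closedBall_zero_iff]
      linarith
    obtain ⟨y, -, hy⟩ := (isCompact_closedBall (0 : E) (‖x‖ + 3)).ultrafilter_le_nhds
      ((hyperfilter ℕ).map fun n : ℕ => (n : ℝ)⁻¹ • q (w x n)) (by
        rw [le_principal_iff]; exact hbdd)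
    exact ⟨y, hy⟩
  choose U hUlim using hlim
  have hU : Isometry U := Isometry.of_dist_eq fun x y =>
    hdist _ _ _ _ _ _ (hwlim x) (hwlim y) (hUlim x) (hUlim y)
  have hU0 : U 0 = 0 := by
    let i₀ := w 0 0
    have h1 : Tendsto (fun n : ℕ => (n : ℝ)⁻¹ • p i₀) (hyperfilter ℕ) (𝓝 0) := by
      simpa using hinv.smul_const (p i₀)
    have h2 : Tendsto (fun n : ℕ => (n : ℝ)⁻¹ • q i₀) (hyperfilter ℕ) (𝓝 0) := by
      simpa using hinv.smul_const (q i₀)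
    have := hdist _ (fun _ => i₀) _ _ _ _ (hwlim 0) h1 (hUlim 0) h2
    simpa using this
  let Ue : E ≃ᵢ E := ⟨Equiv.ofBijective U ⟨hU.injective, hU.surjective_of_map_zero hU0⟩, hU⟩
  refine ⟨Ue.toRealLinearIsometryEquivOfMapZero hU0, fun v x hv => ?_⟩
  exact hclose v (w x) x (U x) hv (hwlim x) (hUlim x)

/-! ### Derivatives of the norm seen from infinity -/

/-- By convexity, difference quotients of the norm do not decrease when the step grows. -/
theorem norm_add_sub_norm_le {E : Type*} [NormedAddCommGroup E] [NormedSpace ℝ E] (a h : E)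
    {T : ℝ} (hT : 1 ≤ T) : ‖a + h‖ - ‖a‖ ≤ (‖a + T • h‖ - ‖a‖) / T := by
  have hT0 : 0 < T := by linarith
  have h1 : T • (a + h) = (T - 1) • a + (a + T • h) := by module
  have h2 : T * ‖a + h‖ ≤ (T - 1) * ‖a‖ + ‖a + T • h‖ := by
    have := norm_add_le ((T - 1) • a) (a + T • h)
    rw [← h1, norm_smul, norm_smul, Real.norm_of_nonneg hT0.le,
      Real.norm_of_nonneg (by linarith)] at this
    exact this
  rw [le_div_iff₀ hT0]
  linarith

theorem eventually_norm_add_sub_norm_lt {E : Type*} [NormedAddCommGroup E] [NormedSpace ℝ E]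
    {z : E} {l : E →L[ℝ] ℝ} (hz : HasFDerivAt (fun x : E => ‖x‖) l z) {F : Filter ℕ}
    (hF : F ≤ atTop) {a : ℕ → E} (ha : Tendsto (fun n : ℕ => (n : ℝ)⁻¹ • a n) F (𝓝 z)) (h : E)
    {c : ℝ} (hc : l h < c) : ∀ᶠ n in F, ‖a n + h‖ - ‖a n‖ < c := by
  have hd : HasDerivAt (fun t : ℝ => ‖z + t • h‖) (l h) 0 := hz.hasLineDerivAt h
  have hs := hd.tendsto_slope_zero_right.eventually (gt_mem_nhds hc)
  obtain ⟨s, hs, hs0⟩ := (hs.and self_mem_nhdsWithin).exists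
  replace hs0 : 0 < s := hs0
  have hs' : (‖z + s • h‖ - ‖z‖) / s < c := by
    simpa [div_eq_inv_mul] using hs
  have hlim : Tendsto (fun n : ℕ => (‖(n : ℝ)⁻¹ • a n + s • h‖ - ‖(n : ℝ)⁻¹ • a n‖) / s) F
      (𝓝 ((‖z + s • h‖ - ‖z‖) / s)) :=
    (((ha.add_const _).norm).sub ha.norm).div_const s
  have hlarge : ∀ᶠ n : ℕ in F, s⁻¹ ≤ (n : ℝ) :=
    hF (tendsto_natCast_atTop_atTop.eventually_ge_atTop s⁻¹)
  filter_upwards [hlim.eventually (gt_mem_nhds hs'), hlarge] with n h1 h2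
  have hn : (0 : ℝ) < n := (inv_pos.2 hs0).trans_le h2
  have hT : 1 ≤ (n : ℝ) * s := by
    rwa [inv_le_iff_one_le_mul₀ hs0] at h2
  refine (norm_add_sub_norm_le (a n) h hT).trans_lt (lt_of_eq_of_lt ?_ h1)
  have e1 : (n : ℝ)⁻¹ • a n + s • h = (n : ℝ)⁻¹ • (a n + ((n : ℝ) * s) • h) := by
    rw [smul_add, smul_smul, inv_mul_cancel_left₀ hn.ne']
  rw [e1, norm_smul, norm_smul, norm_inv, RCLike.norm_natCast]
  field_simp

/-- If the norm has derivative `l` at `z`, then far out in the direction of `z` the norm differs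
from `l` by an additive term that is asymptotically constant on bounded regions. Only the direction
of `a n` has to converge: by convexity, a unit step at `a n` is controlled by a short step of fixed
length at `(n : ℝ)⁻¹ • a n`. -/
theorem tendsto_norm_add_sub_norm {E : Type*} [NormedAddCommGroup E] [NormedSpace ℝ E]
    {z : E} {l : E →L[ℝ] ℝ} (hz : HasFDerivAt (fun x : E => ‖x‖) l z) {F : Filter ℕ}
    (hF : F ≤ atTop) {a : ℕ → E} (ha : Tendsto (fun n : ℕ => (n : ℝ)⁻¹ • a n) F (𝓝 z)) (h : E) :
    Tendsto (fun n => ‖a n + h‖ - ‖a n‖) F (𝓝 (l h)) := by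
  refine tendsto_order.2 ⟨fun c hc => ?_, fun c hc =>
    eventually_norm_add_sub_norm_lt hz hF ha h hc⟩
  have ha' : Tendsto (fun n : ℕ => (n : ℝ)⁻¹ • (a n + h)) F (𝓝 z) := by
    have h0 : Tendsto (fun n : ℕ => (n : ℝ)⁻¹ • h) F (𝓝 0) := by
      simpa using ((tendsto_inv_atTop_nhds_zero_nat (𝕜 := ℝ)).mono_left hF).smul_const h
    simpa [smul_add] using ha.add h0
  have := eventually_norm_add_sub_norm_lt hz hF ha' (-h) (c := -c) (by simpa using hc)
  filter_upwards [this] with n hn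
  rw [add_neg_cancel_right] at hn
  linarith

/-- A step-isometry `p i ↦ q i` that is asymptotic to the identity respects, up to integer
thresholds, the order given by every derivative `l` of the norm: a difference of `l` larger than
`m` is detected by a distant point of the dense family at distance just below an integer from
`p i`. -/
theorem le_fderiv_norm_of_step {ι E : Type*} [NormedAddCommGroup E] [NormedSpace ℝ E]
    {p q : ι → E} (hp : DenseRange p) (hfl : ∀ i j, ⌊‖p i - p j‖⌋ = ⌊‖q i - q j‖⌋)
    (hasym : ∀ (w : ℕ → ι) (x : E),
      Tendsto (fun n : ℕ => (n : ℝ)⁻¹ • p (w n)) (hyperfilter ℕ) (𝓝 x) →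
      Tendsto (fun n : ℕ => (n : ℝ)⁻¹ • q (w n)) (hyperfilter ℕ) (𝓝 x))
    {z : E} {l : E →L[ℝ] ℝ} (hz1 : ‖z‖ = 1) (hz : HasFDerivAt (fun x : E => ‖x‖) l z)
    {i j : ι} {m : ℤ} (hm : (m : ℝ) < l (p j - p i)) : (m : ℝ) ≤ l (q j - q i) := by
  set ε : ℝ := l (p j - p i) - m with hε
  have hε0 : 0 < ε := by linarith
  have hw : ∀ n : ℕ, ∃ k, ‖p k - (p i - ((n : ℝ) - ε / 2) • z)‖ < ε / 4 := by
    intro n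
    obtain ⟨k, hk⟩ := hp.exists_dist_lt (p i - ((n : ℝ) - ε / 2) • z) (by positivity : 0 < ε / 4)
    rw [dist_comm, dist_eq_norm] at hk
    exact ⟨k, hk⟩
  choose w hw using hw
  have hinv : Tendsto (fun n : ℕ => (n : ℝ)⁻¹) (hyperfilter ℕ) (𝓝 0) :=
    (tendsto_inv_atTop_nhds_zero_nat (𝕜 := ℝ)).mono_left hyperfilter_nat_le_atTop
  have hpw : Tendsto (fun n : ℕ => (n : ℝ)⁻¹ • p (w n)) (hyperfilter ℕ) (𝓝 (-z)) := by
    refine (tendsto_inv_natCast_smul (C := ε / 4 + ‖p i + (ε / 2) • z‖) fun n => ?_).mono_left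
      hyperfilter_nat_le_atTop
    have : p (w n) - (n : ℝ) • -z
        = (p (w n) - (p i - ((n : ℝ) - ε / 2) • z)) + (p i + (ε / 2) • z) := by module
    rw [this]
    exact (norm_add_le _ _).trans (by gcongr; exact (hw n).le)
  have hqw := hasym w (-z) hpw
  have hshift : ∀ (r : ℕ → E) (x : E),
      Tendsto (fun n : ℕ => (n : ℝ)⁻¹ • r n) (hyperfilter ℕ) (𝓝 (-z)) →
      Tendsto (fun n : ℕ => (n : ℝ)⁻¹ • (x - r n)) (hyperfilter ℕ) (𝓝 z) := by
    intro r x hr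
    have := (hinv.smul_const x).sub hr
    simpa [smul_sub] using this
  have hP := tendsto_norm_add_sub_norm hz hyperfilter_nat_le_atTop (hshift _ (p i) hpw) (p j - p i)
  have hQ := tendsto_norm_add_sub_norm hz hyperfilter_nat_le_atTop (hshift _ (q i) hqw) (q j - q i)
  refine ge_of_tendsto hQ ?_
  have hlarge : ∀ᶠ n : ℕ in (hyperfilter ℕ : Filter ℕ), ε / 2 ≤ (n : ℝ) :=
    hyperfilter_nat_le_atTop (tendsto_natCast_atTop_atTop.eventually_ge_atTop _)
  filter_upwards [hlarge, hP.eventually (lt_mem_nhds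
    (show (m : ℝ) + 3 * ε / 4 < l (p j - p i) by linarith))] with n hn h1
  have e1 : ∀ r : ι → E, r i - r (w n) + (r j - r i) = r j - r (w n) := fun r => by abel
  rw [e1 p] at h1
  rw [e1 q]
  have hz2 : ‖((n : ℝ) - ε / 2) • z‖ = (n : ℝ) - ε / 2 := by
    rw [norm_smul, hz1, mul_one, Real.norm_of_nonneg (by linarith)]
  have hdev : ‖(p i - p (w n)) - ((n : ℝ) - ε / 2) • z‖ < ε / 4 := by
    have := hw n
    rw [← norm_neg] at this
    convert! this using 2
    abel
  have hdev' := abs_lt.1 ((abs_norm_sub_norm_le _ _).trans_lt hdev)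
  rw [hz2] at hdev'
  have h2 : ‖q i - q (w n)‖ < (n : ℤ) := by
    rw [← Int.floor_lt, ← hfl, Int.floor_lt]
    push_cast
    linarith [hdev'.2]
  have h3 : (((n : ℤ) + m : ℤ) : ℝ) ≤ ‖q j - q (w n)‖ := by
    rw [← Int.le_floor, ← hfl, Int.le_floor]
    push_cast
    linarith [hdev'.1]
  push_cast at h2 h3
  linarith

/-! ### Monotone functions along three directions -/

theorem exists_eq_mul_of_additive_of_monotone {ψ : ℝ → ℝ} (hadd : ∀ s t, ψ (s + t) = ψ s + ψ t)
    (hmono : Monotone ψ) : ∃ c, ∀ s, ψ s = c * s := by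
  let f : ℝ →+ ℝ := AddMonoidHom.mk' ψ hadd
  have hf : Continuous f := MeasureTheory.Measure.AddMonoidHom.continuous_of_measurable f hmono.measurable
  refine ⟨ψ 1, fun s => ?_⟩
  have := map_real_smul f hf s 1
  simpa [f, mul_comm] using this

/-- A monotone solution of Pexider's equation is affine. -/
theorem exists_affine_of_pexider {φ₁ φ₂ φ₃ : ℝ → ℝ} {a b : ℝ} (ha : a ≠ 0) (hb : b ≠ 0)
    (hmono : Monotone φ₁) (h : ∀ s t, φ₃ (a * s + b * t) = a * φ₁ s + b * φ₂ t) :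
    ∃ c d, ∀ s, φ₁ s = c * s + d := by
  have hdiff : ∀ s r, φ₁ (s + r) - φ₁ s = φ₁ r - φ₁ 0 := by
    intro s r
    -- `t` is chosen to cancel the contribution of `s` to the argument of `φ₃`
    have h1 := h (s + r) (-(a * s) / b)
    have h2 := h s (-(a * s) / b)
    have h3 := h r 0
    have h4 := h 0 0
    have e1 : a * (s + r) + b * (-(a * s) / b) = a * r + b * 0 := by field_simp; ring
    have e2 : a * s + b * (-(a * s) / b) = a * 0 + b * 0 := by field_simp; ring
    rw [e1] at h1
    rw [e2] at h2
    have : a * (φ₁ (s + r) - φ₁ s) = a * (φ₁ r - φ₁ 0) := by linarith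
    exact mul_left_cancel₀ ha this
  obtain ⟨c, hc⟩ := exists_eq_mul_of_additive_of_monotone (ψ := fun s => φ₁ s - φ₁ 0)
    (fun s t => by have := hdiff s t; linarith) (fun s t hst => by
      have := hmono hst
      simpa using this)
  exact ⟨c, φ₁ 0, fun s => by have := hc s; linarith⟩

/-- The supremum of the `y i` over all `i` with `x i < s`. If the `y i` respect the order of the
`x i` and the latter are dense, this is a monotone function of `s`, finite everywhere, and `y i`
lies between its value and its right limit at `x i`. -/
noncomputable def leftEnvelope {ι : Type*} (x y : ι → ℝ) (s : ℝ) : ℝ :=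
  sSup (y '' {i | x i < s})

section LeftEnvelope

variable {ι : Type*} {x y : ι → ℝ}

theorem isLUB_leftEnvelope (hx : DenseRange x) (hxy : ∀ i j, x i < x j → y i ≤ y j) (s : ℝ) :
    IsLUB (y '' {i | x i < s}) (leftEnvelope x y s) := by
  obtain ⟨i, hi⟩ := hx.exists_mem_open isOpen_Iio ⟨s - 1, sub_one_lt s⟩
  obtain ⟨j, hj⟩ := hx.exists_mem_open isOpen_Ioi ⟨s + 1, lt_add_one s⟩
  refine isLUB_csSup ⟨y i, i, hi, rfl⟩ ⟨y j, ?_⟩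
  rintro _ ⟨k, hk, rfl⟩
  exact hxy k j (lt_trans hk hj)

theorem le_leftEnvelope (hx : DenseRange x) (hxy : ∀ i j, x i < x j → y i ≤ y j) {s : ℝ} {i : ι}
    (hi : x i < s) : y i ≤ leftEnvelope x y s :=
  (isLUB_leftEnvelope hx hxy s).1 ⟨i, hi, rfl⟩

theorem leftEnvelope_le (hx : DenseRange x) (hxy : ∀ i j, x i < x j → y i ≤ y j) {s c : ℝ}
    (h : ∀ i, x i < s → y i ≤ c) : leftEnvelope x y s ≤ c := by
  refine (isLUB_leftEnvelope hx hxy s).2 ?_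
  rintro _ ⟨k, hk, rfl⟩
  exact h k hk

theorem leftEnvelope_mono (hx : DenseRange x) (hxy : ∀ i j, x i < x j → y i ≤ y j) :
    Monotone (leftEnvelope x y) := fun _ _ hst =>
  leftEnvelope_le hx hxy fun _ hi => le_leftEnvelope hx hxy (hi.trans_le hst)

end LeftEnvelope

/-- If a dense family of points of the plane is mapped so that the order of the first coordinates,
of the second coordinates and of a positive combination of both is respected, then the first
coordinate is transformed by an affine function. -/
theorem exists_affine_of_order {ι : Type*} {x₁ x₂ y₁ y₂ : ι → ℝ} {a b : ℝ} (ha : 0 < a)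
    (hb : 0 < b) (hx : DenseRange fun i => (x₁ i, x₂ i))
    (h₁ : ∀ i j, x₁ i < x₁ j → y₁ i ≤ y₁ j) (h₂ : ∀ i j, x₂ i < x₂ j → y₂ i ≤ y₂ j)
    (h₃ : ∀ i j, a * x₁ i + b * x₂ i < a * x₁ j + b * x₂ j →
      a * y₁ i + b * y₂ i ≤ a * y₁ j + b * y₂ j) :
    ∃ c d, ∀ i, y₁ i = c * x₁ i + d := by
  have hbox : ∀ s' s t' t : ℝ, s' < s → t' < t →
      ∃ j, (s' < x₁ j ∧ x₁ j < s) ∧ (t' < x₂ j ∧ x₂ j < t) := by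
    intro s' s t' t hs ht
    obtain ⟨u, hu⟩ := exists_between hs
    obtain ⟨v, hv⟩ := exists_between ht
    obtain ⟨j, hj⟩ := hx.exists_mem_open
      ((isOpen_Ioo (a := s') (b := s)).prod (isOpen_Ioo (a := t') (b := t))) ⟨(u, v), hu, hv⟩
    exact ⟨j, hj.1, hj.2⟩
  have hx₁ : DenseRange x₁ :=
    (Prod.fst_surjective.denseRange).comp hx continuous_fst
  have hx₂ : DenseRange x₂ :=
    (Prod.snd_surjective.denseRange).comp hx continuous_snd
  have hx₃ : DenseRange fun i => a * x₁ i + b * x₂ i := by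
    have hsurj : Function.Surjective fun z : ℝ × ℝ => a * z.1 + b * z.2 := fun r =>
      ⟨(r / a, 0), by simp [mul_div_cancel₀ r ha.ne']⟩
    exact hsurj.denseRange.comp hx (by fun_prop)
  have hpex : ∀ s t, leftEnvelope (fun i => a * x₁ i + b * x₂ i) (fun i => a * y₁ i + b * y₂ i)
      (a * s + b * t) = a * leftEnvelope x₁ y₁ s + b * leftEnvelope x₂ y₂ t := by
    intro s t
    apply le_antisymm
    · refine leftEnvelope_le hx₃ h₃ fun i hi => ?_
      -- a point slightly below `(s, t)` in both coordinates still lies above `i`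
      set δ := (a * s + b * t - (a * x₁ i + b * x₂ i)) / (a + b) with hδ
      have hδ0 : 0 < δ := by apply div_pos <;> linarith
      have hδe : δ * (a + b) = a * s + b * t - (a * x₁ i + b * x₂ i) :=
        div_mul_cancel₀ _ (by positivity)
      obtain ⟨j, ⟨hj1, hj2⟩, hj3, hj4⟩ := hbox (s - δ) s (t - δ) t (by linarith) (by linarith)
      have e1 := mul_lt_mul_of_pos_left hj1 ha
      have e2 := mul_lt_mul_of_pos_left hj3 hb
      refine (h₃ i j (by linarith)).trans ?_
      exact add_le_add (mul_le_mul_of_nonneg_left (le_leftEnvelope hx₁ h₁ hj2) ha.le)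
        (mul_le_mul_of_nonneg_left (le_leftEnvelope hx₂ h₂ hj4) hb.le)
    · set c := leftEnvelope (fun i => a * x₁ i + b * x₂ i) (fun i => a * y₁ i + b * y₂ i)
        (a * s + b * t) with hc
      have key : ∀ i k, x₁ i < s → x₂ k < t → a * y₁ i + b * y₂ k ≤ c := by
        intro i k hi hk
        obtain ⟨j, ⟨hj1, hj2⟩, hj3, hj4⟩ := hbox _ _ _ _ hi hk
        have e1 := mul_le_mul_of_nonneg_left (h₁ _ _ hj1) ha.le
        have e2 := mul_le_mul_of_nonneg_left (h₂ _ _ hj3) hb.le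
        have e3 := mul_lt_mul_of_pos_left hj2 ha
        have e4 := mul_lt_mul_of_pos_left hj4 hb
        refine le_trans (by linarith) (le_leftEnvelope hx₃ h₃ (i := j) (by linarith))
      have key2 : ∀ k, x₂ k < t → leftEnvelope x₁ y₁ s ≤ (c - b * y₂ k) / a := fun k hk =>
        leftEnvelope_le hx₁ h₁ fun i hi => by
          rw [le_div_iff₀ ha]; linarith [key i k hi hk]
      have key3 : leftEnvelope x₂ y₂ t ≤ (c - a * leftEnvelope x₁ y₁ s) / b :=
        leftEnvelope_le hx₂ h₂ fun k hk => by
          have := key2 k hk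
          rw [le_div_iff₀ ha] at this
          rw [le_div_iff₀ hb]; linarith
      rw [le_div_iff₀ hb] at key3
      linarith
  obtain ⟨c, d, hcd⟩ := exists_affine_of_pexider ha.ne' hb.ne' (leftEnvelope_mono hx₁ h₁) hpex
  refine ⟨c, d, fun i => le_antisymm ?_ ?_⟩
  · -- `y₁ i` is at most the right limit of the envelope at `x₁ i`, and the envelope is continuous
    have hcont : ContinuousWithinAt (fun s => c * s + d) (Set.Ioi (x₁ i)) (x₁ i) := by
      fun_prop
    refine ge_of_tendsto hcont ?_
    filter_upwards [self_mem_nhdsWithin] with s hs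
    rw [← hcd]
    exact le_leftEnvelope hx₁ h₁ hs
  · rw [← hcd]
    exact leftEnvelope_le hx₁ h₁ fun k hk => h₁ k i hk

/-- Integer thresholds leave `1` as the only possible slope. -/
theorem slope_eq_one_of_integer_thresholds {ι : Type*} {x y : ι → ℝ} (hx : DenseRange x) {c d : ℝ}
    (hy : ∀ i, y i = c * x i + d)
    (hxy : ∀ i j (m : ℤ), (m : ℝ) < x j - x i → (m : ℝ) ≤ y j - y i) : c = 1 := by
  obtain ⟨i⟩ : Nonempty ι := hx.nonempty
  have hlow : ∀ j, 1 < x j - x i → 1 ≤ c * (x j - x i) := fun j hj => by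
    have := hxy i j 1 (by simpa using hj)
    rw [hy, hy] at this
    push_cast at this
    linarith
  have hup : ∀ j, x j - x i < 1 → c * (x j - x i) ≤ 1 := fun j hj => by
    have := hxy j i (-1) (by push_cast; linarith)
    rw [hy, hy] at this
    push_cast at this
    linarith
  apply le_antisymm
  · by_contra hc
    rw [not_le] at hc
    have hlt : x i + c⁻¹ < x i + 1 := by
      have := inv_lt_one_of_one_lt₀ hc
      linarith
    obtain ⟨u, hu⟩ := exists_between hlt
    obtain ⟨j, hj⟩ := hx.exists_mem_open isOpen_Ioo ⟨u, hu⟩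
    have h1 := hup j (by linarith [hj.2])
    have h2 : c * c⁻¹ < c * (x j - x i) :=
      mul_lt_mul_of_pos_left (by linarith [hj.1]) (by linarith)
    rw [mul_inv_cancel₀ (by linarith)] at h2
    linarith
  · by_contra hc
    rw [not_le] at hc
    obtain ⟨j₀, hj₀⟩ := hx.exists_mem_open isOpen_Ioi
      ⟨x i + 1 + 1, lt_add_one (x i + 1)⟩
    have hc0 : 0 < c := by
      have h1 := hlow j₀ (by linarith [Set.mem_Ioi.1 hj₀])
      by_contra hneg
      rw [not_lt] at hneg
      have := mul_nonpos_of_nonpos_of_nonneg hneg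
        (by linarith [Set.mem_Ioi.1 hj₀] : 0 ≤ x j₀ - x i)
      linarith
    have hlt : x i + 1 < x i + c⁻¹ := by
      have := (one_lt_inv₀ hc0).2 hc
      linarith
    obtain ⟨u, hu⟩ := exists_between hlt
    obtain ⟨j, hj⟩ := hx.exists_mem_open isOpen_Ioo ⟨u, hu⟩
    have h1 := hlow j (by linarith [hj.1])
    have h2 : c * (x j - x i) < c * c⁻¹ :=
      mul_lt_mul_of_pos_left (by linarith [hj.2]) hc0
    rw [mul_inv_cancel₀ hc0.ne'] at h2
    linarith

theorem sub_eq_of_integer_thresholds_fst {ι : Type*} {x₁ x₂ y₁ y₂ : ι → ℝ} {a b : ℝ} (ha : 0 < a)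
    (hb : 0 < b) (hx : DenseRange fun i => (x₁ i, x₂ i))
    (h₁ : ∀ i j (m : ℤ), (m : ℝ) < x₁ j - x₁ i → (m : ℝ) ≤ y₁ j - y₁ i)
    (h₂ : ∀ i j (m : ℤ), (m : ℝ) < x₂ j - x₂ i → (m : ℝ) ≤ y₂ j - y₂ i)
    (h₃ : ∀ i j (m : ℤ), (m : ℝ) < a * (x₁ j - x₁ i) + b * (x₂ j - x₂ i) →
      (m : ℝ) ≤ a * (y₁ j - y₁ i) + b * (y₂ j - y₂ i)) (i j : ι) :
    y₁ j - y₁ i = x₁ j - x₁ i := by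
  obtain ⟨c, d, hcd⟩ := exists_affine_of_order ha hb hx
    (fun i j hij => by have := h₁ i j 0 (by simpa using hij); simpa using this)
    (fun i j hij => by have := h₂ i j 0 (by simpa using hij); simpa using this)
    (fun i j hij => by
      have := h₃ i j 0 (by push_cast; linarith)
      push_cast at this; linarith)
  have hc := slope_eq_one_of_integer_thresholds
    ((Prod.fst_surjective.denseRange).comp hx continuous_fst) hcd h₁
  rw [hcd, hcd, hc]
  ring

theorem sub_eq_of_integer_thresholds_pos {ι : Type*} {x₁ x₂ y₁ y₂ : ι → ℝ} {a b : ℝ} (ha : 0 < a)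
    (hb : 0 < b) (hx : DenseRange fun i => (x₁ i, x₂ i))
    (h₁ : ∀ i j (m : ℤ), (m : ℝ) < x₁ j - x₁ i → (m : ℝ) ≤ y₁ j - y₁ i)
    (h₂ : ∀ i j (m : ℤ), (m : ℝ) < x₂ j - x₂ i → (m : ℝ) ≤ y₂ j - y₂ i)
    (h₃ : ∀ i j (m : ℤ), (m : ℝ) < a * (x₁ j - x₁ i) + b * (x₂ j - x₂ i) →
      (m : ℝ) ≤ a * (y₁ j - y₁ i) + b * (y₂ j - y₂ i)) (i j : ι) :
    y₁ j - y₁ i = x₁ j - x₁ i ∧ y₂ j - y₂ i = x₂ j - x₂ i :=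
  ⟨sub_eq_of_integer_thresholds_fst ha hb hx h₁ h₂ h₃ i j,
    sub_eq_of_integer_thresholds_fst hb ha
      (Prod.swap_surjective.denseRange.comp hx continuous_swap) h₂ h₁
      (fun i j m hm => by rw [add_comm]; exact h₃ i j m (by rwa [add_comm])) i j⟩

/-- A transformation of a dense family of points of the plane that respects integer thresholds for
three pairwise non-proportional linear functionals is a translation. -/
theorem sub_eq_of_integer_thresholds {ι : Type*} {x₁ x₂ y₁ y₂ : ι → ℝ} {a b : ℝ} (ha : a ≠ 0)
    (hb : b ≠ 0) (hx : DenseRange fun i => (x₁ i, x₂ i))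
    (h₁ : ∀ i j (m : ℤ), (m : ℝ) < x₁ j - x₁ i → (m : ℝ) ≤ y₁ j - y₁ i)
    (h₂ : ∀ i j (m : ℤ), (m : ℝ) < x₂ j - x₂ i → (m : ℝ) ≤ y₂ j - y₂ i)
    (h₃ : ∀ i j (m : ℤ), (m : ℝ) < a * (x₁ j - x₁ i) + b * (x₂ j - x₂ i) →
      (m : ℝ) ≤ a * (y₁ j - y₁ i) + b * (y₂ j - y₂ i)) (i j : ι) :
    y₁ j - y₁ i = x₁ j - x₁ i ∧ y₂ j - y₂ i = x₂ j - x₂ i := by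
  -- negating a coordinate exchanges the roles of `i` and `j` and makes its coefficient positive
  wlog ha' : 0 < a generalizing x₁ y₁ a
  · have hneg : Function.Surjective fun z : ℝ × ℝ => (-z.1, z.2) := fun z => ⟨(-z.1, z.2), by simp⟩
    have := this (x₁ := fun i => -x₁ i) (y₁ := fun i => -y₁ i) (neg_ne_zero.2 ha)
      (hneg.denseRange.comp hx (by fun_prop))
      (fun i j m hm => by have := h₁ j i m (by linarith); linarith)
      (fun i j m hm => by have := h₃ i j m (by linarith); linarith)
      (by have := lt_of_le_of_ne (not_lt.1 ha') ha; linarith)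
    exact ⟨by linarith [this.1], this.2⟩
  wlog hb' : 0 < b generalizing x₂ y₂ b
  · have hneg : Function.Surjective fun z : ℝ × ℝ => (z.1, -z.2) := fun z => ⟨(z.1, -z.2), by simp⟩
    have := this (x₂ := fun i => -x₂ i) (y₂ := fun i => -y₂ i) (neg_ne_zero.2 hb)
      (fun i j m hm => by have := h₂ j i m (by linarith); linarith)
      (hneg.denseRange.comp hx (by fun_prop))
      (fun i j m hm => by have := h₃ i j m (by linarith); linarith)
      (by have := lt_of_le_of_ne (not_lt.1 hb') hb; linarith)
    exact ⟨this.1, by linarith [this.2]⟩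
  exact sub_eq_of_integer_thresholds_pos ha' hb' hx h₁ h₂ h₃ i j

/-! ### Derivatives of a planar norm -/

theorem dense_exists_fderiv_norm {E : Type*} [NormedAddCommGroup E] [NormedSpace ℝ E]
    [FiniteDimensional ℝ E] [Nontrivial E] :
    Dense {x : E | ∃ l : E →L[ℝ] ℝ,
      (∃ z, ‖z‖ = 1 ∧ HasFDerivAt (fun y : E => ‖y‖) l z) ∧ ‖l‖ = 1 ∧ l x = ‖x‖} := by
  refine (dense_differentiableAt_norm (E := E)).mono fun x hx => ?_
  have hx0 : x ≠ 0 := fun h => not_differentiableAt_norm_zero E (h ▸ hx)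
  refine ⟨fderiv ℝ (fun y : E => ‖y‖) x, ⟨‖x‖⁻¹ • x, norm_smul_inv_norm (𝕜 := ℝ) hx0, ?_⟩,
    norm_fderiv_norm hx, DifferentiableAt.fderiv_norm_self hx⟩
  exact (DifferentiableAt.hasFDerivAt hx).hasFDerivAt_norm_smul_pos (inv_pos.2 (norm_pos_iff.2 hx0))

/-- A planar norm is either the maximum of the absolute values of two functionals, or it has three
pairwise non-proportional derivatives. This is where parallelograms are singled out: the norm is
the maximum of its own derivatives, which exist at a dense set of points. -/
theorem norm_eq_max_or_exists_three_fderiv {E : Type*} [NormedAddCommGroup E] [NormedSpace ℝ E]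
    (hE : Module.finrank ℝ E = 2) :
    (∃ l₁ l₂ : E →L[ℝ] ℝ, ∀ x, ‖x‖ = max |l₁ x| |l₂ x|) ∨
    ∃ (l₁ l₂ l₃ : E →L[ℝ] ℝ) (a b : ℝ), a ≠ 0 ∧ b ≠ 0 ∧ l₃ = a • l₁ + b • l₂ ∧
      Function.Bijective (fun x => (l₁ x, l₂ x)) ∧
      ∀ l ∈ ({l₁, l₂, l₃} : Set (E →L[ℝ] ℝ)), ∃ z, ‖z‖ = 1 ∧ HasFDerivAt (fun y : E => ‖y‖) l z := by
  have : FiniteDimensional ℝ E := Module.finite_of_finrank_eq_succ hE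
  have : Nontrivial E := Module.nontrivial_of_finrank_eq_succ hE
  set D : Set (E →L[ℝ] ℝ) :=
    {l | (∃ z, ‖z‖ = 1 ∧ HasFDerivAt (fun y : E => ‖y‖) l z) ∧ ‖l‖ = 1} with hD
  have hdense : Dense {x : E | ∃ l ∈ D, l x = ‖x‖} := by
    refine dense_exists_fderiv_norm.mono ?_
    rintro x ⟨l, h1, h2, h3⟩
    exact ⟨l, ⟨h1, h2⟩, h3⟩
  have hle : ∀ l ∈ D, ∀ x, |l x| ≤ ‖x‖ := fun l hl x => by
    have := l.le_opNorm x
    rwa [hl.2, one_mul] at this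
  have hmax : ∀ l₁ ∈ D, ∀ l₂ ∈ D, (∀ l ∈ D, l = l₁ ∨ l = -l₁ ∨ l = l₂ ∨ l = -l₂) →
      ∀ x, ‖x‖ = max |l₁ x| |l₂ x| := by
    intro l₁ h₁ l₂ h₂ hall
    have : (fun x : E => ‖x‖) = fun x => max |l₁ x| |l₂ x| := by
      refine Continuous.ext_on hdense (by fun_prop) (by fun_prop) ?_
      rintro x ⟨l, hl, hlx⟩
      refine le_antisymm ?_ (max_le (hle l₁ h₁ x) (hle l₂ h₂ x))
      simp only [← hlx, le_max_iff]
      rcases hall l hl with rfl | rfl | rfl | rfl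
      · exact Or.inl (le_abs_self _)
      · exact Or.inl (neg_le_abs _)
      · exact Or.inr (le_abs_self _)
      · exact Or.inr (neg_le_abs _)
    exact fun x => congrFun this x
  have hprop : ∀ l ∈ D, ∀ l' ∈ D, ∀ c : ℝ, l' = c • l → l' = l ∨ l' = -l := by
    intro l hl l' hl' c hc
    have h1 : |c| = 1 := by
      have := congrArg norm hc
      rwa [norm_smul, hl.2, hl'.2, mul_one, eq_comm] at this
    rcases (abs_eq zero_le_one).1 h1 with rfl | rfl
    · left; simpa using hc
    · right; ext x; simp [hc]
  obtain ⟨_, l₁, h₁, -⟩ := hdense.nonempty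
  by_cases hone : ∀ l ∈ D, l = l₁ ∨ l = -l₁
  · exact Or.inl ⟨l₁, l₁, hmax l₁ h₁ l₁ h₁ fun l hl => by rcases hone l hl with h | h <;> simp [h]⟩
  push Not at hone
  obtain ⟨l₂, h₂, h21, h21'⟩ := hone
  by_cases htwo : ∀ l ∈ D, l = l₁ ∨ l = -l₁ ∨ l = l₂ ∨ l = -l₂
  · exact Or.inl ⟨l₁, l₂, hmax l₁ h₁ l₂ h₂ htwo⟩
  push Not at htwo
  obtain ⟨l₃, h₃, h31, h31', h32, h32'⟩ := htwo
  right
  have hind : LinearIndependent ℝ ![(l₁ : Module.Dual ℝ E), (l₂ : Module.Dual ℝ E)] := by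
    rw [LinearIndependent.pair_iff' (fun h => by
      have h0 : l₁ = 0 := ContinuousLinearMap.coe_injective h
      have := h₁.2
      simp [h0] at this)]
    intro c hc
    have hc' : l₂ = c • l₁ := ContinuousLinearMap.coe_injective (by simpa using hc.symm)
    rcases hprop l₁ h₁ l₂ h₂ c hc' with h | h
    · exact h21 h
    · exact h21' h
  have hspan : Submodule.span ℝ {(l₁ : Module.Dual ℝ E), (l₂ : Module.Dual ℝ E)} = ⊤ := by
    have := hind.span_eq_top_of_card_eq_finrank (by
      rw [Subspace.dual_finrank_eq, hE, Fintype.card_fin])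
    simpa [Matrix.range_cons, Set.pair_comm, Set.insert_comm] using this
  have hcomb : ∀ l : Module.Dual ℝ E,
      ∃ a b : ℝ, a • (l₁ : Module.Dual ℝ E) + b • (l₂ : Module.Dual ℝ E) = l :=
    fun l => Submodule.mem_span_pair.1 (hspan ▸ Submodule.mem_top)
  have hinj : Function.Injective ((l₁ : E →ₗ[ℝ] ℝ).prod (l₂ : E →ₗ[ℝ] ℝ)) := by
    rw [injective_iff_map_eq_zero]
    intro x hx
    rw [LinearMap.prod_apply, Prod.ext_iff] at hx
    rw [← Module.forall_dual_apply_eq_zero_iff ℝ]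
    intro l
    obtain ⟨a, b, rfl⟩ := hcomb l
    have e1 : l₁ x = 0 := hx.1
    have e2 : l₂ x = 0 := hx.2
    simp [e1, e2]
  have hsurj := (LinearMap.injective_iff_surjective_of_finrank_eq_finrank (by simp [hE])).1 hinj
  obtain ⟨a, b, hab⟩ := hcomb l₃
  have hab' : l₃ = a • l₁ + b • l₂ := ContinuousLinearMap.coe_injective (by simpa using hab.symm)
  refine ⟨l₁, l₂, l₃, a, b, ?_, ?_, hab', ⟨hinj, hsurj⟩, ?_⟩
  · rintro rfl
    rcases hprop l₂ h₂ l₃ h₃ b (by simpa using hab') with h | h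
    · exact h32 h
    · exact h32' h
  · rintro rfl
    rcases hprop l₁ h₁ l₃ h₃ a (by simpa using hab') with h | h
    · exact h31 h
    · exact h31' h
  · rintro l (rfl | rfl | rfl)
    exacts [h₁.1, h₂.1, h₃.1]

/-- The truncating property of a planar norm that is not the maximum of the absolute values of two
functionals. -/
theorem norm_sub_eq_of_step {ι E : Type*} [NormedAddCommGroup E] [NormedSpace ℝ E]
    (hE : Module.finrank ℝ E = 2) (hbox : ¬ ∃ l₁ l₂ : E →L[ℝ] ℝ, ∀ x, ‖x‖ = max |l₁ x| |l₂ x|)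
    {p q : ι → E} (hp : DenseRange p) (hfl : ∀ i j, ⌊‖p i - p j‖⌋ = ⌊‖q i - q j‖⌋) (i j : ι) :
    ‖q i - q j‖ = ‖p i - p j‖ := by
  have : FiniteDimensional ℝ E := Module.finite_of_finrank_eq_succ hE
  obtain ⟨l₁, l₂, l₃, a, b, ha, hb, hl₃, hbij, hder⟩ :=
    (norm_eq_max_or_exists_three_fderiv hE).resolve_left hbox
  obtain ⟨U, hU⟩ := exists_linearIsometryEquiv_asymptotic hp fun i j =>
    (Int.abs_sub_lt_one_of_floor_eq_floor (hfl i j).symm).le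
  set r : ι → E := fun i => U.symm (q i) with hr
  have hqr : ∀ i j, ‖q i - q j‖ = ‖r i - r j‖ := fun i j => by
    rw [hr]
    simp only [← map_sub, LinearIsometryEquiv.norm_map]
  have hasym : ∀ (w : ℕ → ι) (x : E),
      Tendsto (fun n : ℕ => (n : ℝ)⁻¹ • p (w n)) (hyperfilter ℕ) (𝓝 x) →
      Tendsto (fun n : ℕ => (n : ℝ)⁻¹ • r (w n)) (hyperfilter ℕ) (𝓝 x) := by
    intro w x hw
    have := (U.symm.continuous.tendsto _).comp (hU w x hw)
    simpa [Function.comp_def, hr] using this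
  have hthr : ∀ l ∈ ({l₁, l₂, l₃} : Set (E →L[ℝ] ℝ)), ∀ i j (m : ℤ),
      (m : ℝ) < l (p j) - l (p i) → (m : ℝ) ≤ l (r j) - l (r i) := by
    intro l hl i j m hm
    obtain ⟨z, hz1, hz⟩ := hder l hl
    rw [← map_sub] at hm ⊢
    exact le_fderiv_norm_of_step hp (fun i j => by rw [hfl, hqr]) hasym hz1 hz hm
  have hdense : DenseRange fun i => (l₁ (p i), l₂ (p i)) :=
    hbij.2.denseRange.comp hp (by fun_prop)
  have key := sub_eq_of_integer_thresholds ha hb hdense (hthr l₁ (by simp)) (hthr l₂ (by simp))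
    (fun i j m hm => by
      have := hthr l₃ (by simp) i j m (by rw [hl₃]; simp; linarith)
      rw [hl₃] at this
      simp at this
      linarith) j i
  have heq : r i - r j = p i - p j := hbij.1 (by
    simp only [map_sub, Prod.mk.injEq]
    exact key)
  rw [hqr, heq]

/-! ### The plane with a norm of its own -/

/-- A copy of the plane that carries the seminorm `N` as its norm, instead of the Euclidean one.
The proof that `N` is definite is a parameter, so that the norm is an instance. -/
def NormedPlane (N : Seminorm ℝ Plane) (_hN : ∀ x, N x = 0 → x = 0) : Type := Plane

namespace NormedPlane

variable {N : Seminorm ℝ Plane} {hN : ∀ x, N x = 0 → x = 0}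

noncomputable instance : AddCommGroup (NormedPlane N hN) := inferInstanceAs (AddCommGroup Plane)

noncomputable instance : Module ℝ (NormedPlane N hN) := inferInstanceAs (Module ℝ Plane)

/-- The identity map from the plane to its renormed copy. -/
noncomputable def of (N : Seminorm ℝ Plane) (hN : ∀ x, N x = 0 → x = 0) :
    Plane ≃ₗ[ℝ] NormedPlane N hN :=
  LinearEquiv.refl ℝ Plane

noncomputable instance : Norm (NormedPlane N hN) := ⟨fun x => N ((of N hN).symm x)⟩

theorem core (N : Seminorm ℝ Plane) (hN : ∀ x, N x = 0 → x = 0) :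
    NormedSpace.Core ℝ (NormedPlane N hN) where
  norm_nonneg x := apply_nonneg N _
  norm_smul c x := map_smul_eq_mul N c _
  norm_triangle x y := map_add_le_add N _ _
  norm_eq_zero_iff x := ⟨fun h => hN _ h, fun h => by subst h; exact map_zero N⟩

noncomputable instance : NormedAddCommGroup (NormedPlane N hN) :=
  NormedAddCommGroup.ofCore (core N hN)

noncomputable instance : NormedSpace ℝ (NormedPlane N hN) := NormedSpace.ofCore (core N hN)

theorem norm_of (x : Plane) : ‖of N hN x‖ = N x := rfl

theorem finrank_eq : Module.finrank ℝ (NormedPlane N hN) = 2 := by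
  rw [← (of N hN).finrank_eq]
  simp

theorem continuous_of : Continuous (of N hN) :=
  LinearMap.continuous_of_finiteDimensional (of N hN).toLinearMap

end NormedPlane

/-! ### Parallelograms and the maximum norm -/

theorem Seminorm.eq_of_le_one_iff {E : Type*} [AddCommGroup E] [Module ℝ E] {N M : Seminorm ℝ E}
    (h : ∀ x, N x ≤ 1 ↔ M x ≤ 1) (x : E) : N x = M x := by
  have hr : ∀ r : ℝ, 0 < r → (N x ≤ r ↔ M x ≤ r) := by
    intro r hr
    have := h (r⁻¹ • x)
    rwa [map_smul_eq_mul, map_smul_eq_mul, norm_inv, Real.norm_of_nonneg hr.le,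
      inv_mul_le_one₀ hr, inv_mul_le_one₀ hr] at this
  refine le_antisymm (le_of_forall_pos_le_add fun ε hε => ?_)
    (le_of_forall_pos_le_add fun ε hε => ?_)
  · exact (hr _ (by have := apply_nonneg M x; linarith)).2 (by linarith)
  · exact (hr _ (by have := apply_nonneg N x; linarith)).1 (by linarith)

theorem mem_parallelepiped_pair {u v x : Plane} : x ∈ parallelepiped ![u, v] ↔
    ∃ s t : ℝ, (0 ≤ s ∧ s ≤ 1) ∧ (0 ≤ t ∧ t ≤ 1) ∧ x = s • u + t • v := by
  rw [mem_parallelepiped_iff]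
  constructor
  · rintro ⟨t, ht, rfl⟩
    exact ⟨t 0, t 1, ⟨ht.1 0, ht.2 0⟩, ⟨ht.1 1, ht.2 1⟩, by simp [Fin.sum_univ_two]⟩
  · rintro ⟨s, t, hs, ht, rfl⟩
    refine ⟨![s, t], ⟨fun i => ?_, fun i => ?_⟩, by simp [Fin.sum_univ_two]⟩
    · fin_cases i
      · exact hs.1
      · exact ht.1
    · fin_cases i
      · exact hs.2
      · exact ht.2

/-- The unit ball of a planar norm is a parallelogram exactly when the norm is the maximum norm in
suitable linear coordinates. -/
theorem isParallelogram_iff_exists_linearEquiv {N : Seminorm ℝ Plane} :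
    IsParallelogram {x | N x ≤ 1} ↔ ∃ e : (ℝ × ℝ) ≃ₗ[ℝ] Plane, ∀ z, N (e z) = ‖z‖ := by
  constructor
  · rintro ⟨c, u, v, hind, hS⟩
    let g : ℝ × ℝ →ₗ[ℝ] Plane :=
      (LinearMap.toSpanSingleton ℝ Plane ((1 / 2 : ℝ) • u)).coprod
        (LinearMap.toSpanSingleton ℝ Plane ((1 / 2 : ℝ) • v))
    have hg : ∀ s t, g (s, t) = (s / 2) • u + (t / 2) • v := fun s t => by
      simp [g, smul_smul, div_eq_mul_inv]
    have hpair := LinearIndependent.pair_iff.1 hind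
    have hinj : Function.Injective g := by
      rw [injective_iff_map_eq_zero]
      rintro ⟨s, t⟩ h
      rw [hg] at h
      obtain ⟨h1, h2⟩ := hpair _ _ h
      ext
      · simp; linarith
      · simp; linarith
    have hsurj :=
      (LinearMap.injective_iff_surjective_of_finrank_eq_finrank (f := g) (by simp)).1 hinj
    let e := LinearEquiv.ofBijective g ⟨hinj, hsurj⟩
    have he : ∀ s t, e (s, t) = (s / 2) • u + (t / 2) • v := hg
    obtain ⟨⟨c₁, c₂⟩, hc⟩ := e.surjective c
    have hmem : ∀ s t, N (e (s, t)) ≤ 1 ↔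
        (c₁ ≤ s ∧ s ≤ c₁ + 2) ∧ (c₂ ≤ t ∧ t ≤ c₂ + 2) := by
      intro s t
      have h1 : N (e (s, t)) ≤ 1 ↔ e (s, t) ∈ (fun x => c + x) '' parallelepiped ![u, v] := by
        rw [← hS]; rfl
      rw [h1]
      constructor
      · rintro ⟨y, hy, hxy⟩
        obtain ⟨a, b, ha, hb, rfl⟩ := mem_parallelepiped_pair.1 hy
        have h2 : e (c₁ + 2 * a, c₂ + 2 * b) = e (s, t) := by
          rw [← hxy, ← hc, he, he]; module
        have h3 := e.injective h2
        rw [Prod.mk.injEq] at h3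
        exact ⟨⟨by linarith [ha.1], by linarith [ha.2]⟩, by linarith [hb.1], by linarith [hb.2]⟩
      · rintro ⟨h2, h3⟩
        refine ⟨((s - c₁) / 2) • u + ((t - c₂) / 2) • v, mem_parallelepiped_pair.2
          ⟨_, _, ⟨by linarith [h2.1], by linarith [h2.2]⟩,
            ⟨by linarith [h3.1], by linarith [h3.2]⟩, rfl⟩, ?_⟩
        simp only [← hc, he]
        module
    have hsymm : ∀ s t, N (e (s, t)) ≤ 1 → N (e (-s, -t)) ≤ 1 := by
      intro s t h
      have : e (-s, -t) = -e (s, t) := by rw [← map_neg]; rfl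
      rwa [this, map_neg_eq_map]
    -- the unit ball is symmetric, so the parallelogram is centred at the origin
    have h1 := (hmem _ _).1 (hsymm _ _ ((hmem c₁ c₂).2
      ⟨⟨le_rfl, by linarith⟩, le_rfl, by linarith⟩))
    have h2 := (hmem _ _).1 (hsymm _ _ ((hmem (c₁ + 2) (c₂ + 2)).2
      ⟨⟨by linarith, le_rfl⟩, by linarith, le_rfl⟩))
    have hc₁ : c₁ = -1 := by linarith [h1.1.2, h2.1.1]
    have hc₂ : c₂ = -1 := by linarith [h1.2.2, h2.2.1]
    refine ⟨e, fun z => ?_⟩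
    refine Seminorm.eq_of_le_one_iff (N := N.comp e.toLinearMap) (M := normSeminorm ℝ (ℝ × ℝ))
      (fun z => ?_) z
    obtain ⟨s, t⟩ := z
    have := hmem s t
    rw [hc₁, hc₂] at this
    norm_num at this
    simpa [Seminorm.comp_apply, Prod.norm_def, abs_le] using this
  · rintro ⟨e, he⟩
    have hcomb : ∀ s t : ℝ, s • e (1, 0) + t • e (0, 1) = e (s, t) := fun s t => by
      rw [← map_smul, ← map_smul, ← map_add]; simp
    refine ⟨-e (1, 1), (2 : ℝ) • e (1, 0), (2 : ℝ) • e (0, 1), ?_, ?_⟩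
    · rw [LinearIndependent.pair_iff]
      intro s t h
      rw [smul_smul, smul_smul, hcomb, map_eq_zero_iff e e.injective] at h
      simpa [Prod.ext_iff] using h
    · ext x
      obtain ⟨⟨s, t⟩, rfl⟩ := e.surjective x
      rw [Set.mem_ofPred_eq, he, Prod.norm_def, max_le_iff, Real.norm_eq_abs, Real.norm_eq_abs,
        abs_le, abs_le]
      constructor
      · rintro ⟨h1, h2⟩
        refine ⟨_, mem_parallelepiped_pair.2 ⟨(s + 1) / 2, (t + 1) / 2,
          ⟨by linarith [h1.1], by linarith [h1.2]⟩, ⟨by linarith [h2.1], by linarith [h2.2]⟩,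
          rfl⟩, ?_⟩
        simp only [smul_smul, hcomb]
        rw [← map_neg, ← map_add]
        congr 1
        ext <;> simp
      · rintro ⟨y, hy, hxy⟩
        obtain ⟨a, b, ha, hb, rfl⟩ := mem_parallelepiped_pair.1 hy
        simp only [smul_smul, hcomb] at hxy
        rw [← map_neg, ← map_add] at hxy
        have h3 := e.injective hxy
        simp only [Prod.neg_mk, Prod.mk_add_mk, Prod.mk.injEq] at h3
        exact ⟨⟨by linarith [ha.1], by linarith [ha.2]⟩, by linarith [hb.1], by linarith [hb.2]⟩

/-! ### A step-isometry of the maximum norm that is not an isometry -/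

/-- The strictly increasing function that commutes with integer translations and squares
fractional parts. Being strictly increasing on fractional parts, it preserves the integer part of
every difference. -/
def squareFract (x : ℚ) : ℚ := ⌊x⌋ + Int.fract x ^ 2

theorem floor_squareFract_sub (x y : ℚ) : ⌊squareFract x - squareFract y⌋ = ⌊x - y⌋ := by
  have hx0 := Int.fract_nonneg x
  have hx1 := Int.fract_lt_one x
  have hy0 := Int.fract_nonneg y
  have hy1 := Int.fract_lt_one y
  have e1 : squareFract x - squareFract y
      = ((⌊x⌋ - ⌊y⌋ : ℤ) : ℚ) + (Int.fract x ^ 2 - Int.fract y ^ 2) := by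
    unfold squareFract; push_cast; ring
  have e2 : x - y = ((⌊x⌋ - ⌊y⌋ : ℤ) : ℚ) + (Int.fract x - Int.fract y) := by
    have h1 := Int.floor_add_fract x
    have h2 := Int.floor_add_fract y
    push_cast; linarith
  rw [e1, e2, Int.floor_intCast_add, Int.floor_intCast_add]
  congr 1
  rcases le_or_gt (Int.fract y) (Int.fract x) with h | h
  · have h1 : ⌊Int.fract x - Int.fract y⌋ = 0 :=
      Int.floor_eq_iff.2 ⟨by push_cast; linarith, by push_cast; linarith⟩
    rw [h1]
    exact Int.floor_eq_iff.2 ⟨by push_cast; nlinarith, by push_cast; nlinarith⟩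
  · have h1 : ⌊Int.fract x - Int.fract y⌋ = -1 :=
      Int.floor_eq_iff.2 ⟨by push_cast; linarith, by push_cast; linarith⟩
    rw [h1]
    exact Int.floor_eq_iff.2 ⟨by push_cast; nlinarith, by push_cast; nlinarith⟩

theorem floor_abs_squareFract_sub (x y : ℚ) : ⌊|squareFract x - squareFract y|⌋ = ⌊|x - y|⌋ := by
  wlog h : y ≤ x generalizing x y
  · rw [abs_sub_comm, abs_sub_comm x]
    exact this y x (le_of_not_ge h)
  have h1 : 0 ≤ squareFract x - squareFract y := by
    rw [← Int.floor_nonneg, floor_squareFract_sub, Int.floor_nonneg]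
    linarith
  rw [abs_of_nonneg h1, abs_of_nonneg (sub_nonneg.2 h), floor_squareFract_sub]

theorem floor_norm_ratCast_sub (a b : ℚ × ℚ) :
    ⌊‖(((a.1 : ℝ), (a.2 : ℝ)) : ℝ × ℝ) - ((b.1 : ℝ), (b.2 : ℝ))‖⌋
      = max ⌊|a.1 - b.1|⌋ ⌊|a.2 - b.2|⌋ := by
  rw [Prod.mk_sub_mk, Prod.norm_def, Real.norm_eq_abs, Real.norm_eq_abs,
    Int.floor_mono.map_max, ← Rat.floor_cast (α := ℝ) |a.1 - b.1|,
    ← Rat.floor_cast (α := ℝ) |a.2 - b.2|]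
  push_cast
  rfl

theorem not_hasTruncatingProperty_of_isParallelogram {d : Plane → Plane → ℝ} {N : Seminorm ℝ Plane}
    (hd : ∀ x y, d x y = N (x - y)) (hN : IsParallelogram {x | N x ≤ 1}) :
    ¬ HasTruncatingProperty d := by
  obtain ⟨e, he⟩ := isParallelogram_iff_exists_linearEquiv.1 hN
  intro htr
  let g : ℚ × ℚ → Plane := fun a => e ((a.1 : ℝ), (a.2 : ℝ))
  have hg : Function.Injective g := by
    intro a b hab
    have := e.injective hab
    simpa [Prod.ext_iff] using this
  have hdist : ∀ a b, d (g a) (g b)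
      = ‖(((a.1 : ℝ), (a.2 : ℝ)) : ℝ × ℝ) - ((b.1 : ℝ), (b.2 : ℝ))‖ := fun a b => by
    rw [hd, ← map_sub, he]
  have hecont : Continuous e := LinearMap.continuous_of_finiteDimensional e.toLinearMap
  have hdense : DenseRange g :=
    e.surjective.denseRange.comp
      ((Rat.denseRange_cast (𝕜 := ℝ)).prodMap (Rat.denseRange_cast (𝕜 := ℝ))) hecont
  let E := Equiv.ofInjective g hg
  have hE : ∀ a, (E a : Plane) = g a := fun a => rfl
  let f : Set.range g → Set.range g := fun v =>
    E (squareFract (E.symm v).1, squareFract (E.symm v).2)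
  have hstep : IsStepIsometry d f := by
    intro u v
    obtain ⟨a, rfl⟩ := E.surjective u
    obtain ⟨b, rfl⟩ := E.surjective v
    simp only [f, Equiv.symm_apply_apply, hE, hdist]
    rw [floor_norm_ratCast_sub a b, floor_norm_ratCast_sub (_, _) (_, _)]
    simp only [floor_abs_squareFract_sub]
  have := htr (Set.range g) (Set.countable_range g) hdense f hstep (E (1 / 2, 0)) (E (0, 0))
  simp only [f, Equiv.symm_apply_apply, hE, hdist] at this
  have h1 : squareFract (1 / 2) = 1 / 4 := by
    have : ⌊(1 / 2 : ℚ)⌋ = 0 := by norm_num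
    rw [squareFract, Int.fract, this]; norm_num
  have h2 : squareFract 0 = 0 := by simp [squareFract]
  rw [h1, h2] at this
  norm_num [Prod.norm_def] at this

theorem hasTruncatingProperty_of_not_isParallelogram {d : Plane → Plane → ℝ}
    {N : Seminorm ℝ Plane} (h0 : ∀ x, N x = 0 → x = 0) (hd : ∀ x y, d x y = N (x - y))
    (hN : ¬ IsParallelogram {x | N x ≤ 1}) : HasTruncatingProperty d := by
  intro V _ hV f hf u v
  have hnorm : ∀ x y : Plane, ‖NormedPlane.of N h0 x - NormedPlane.of N h0 y‖ = d x y :=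
    fun x y => by rw [← map_sub, NormedPlane.norm_of, hd]
  have hdense : DenseRange fun v : V => NormedPlane.of N h0 v :=
    (NormedPlane.of N h0).surjective.denseRange.comp hV.denseRange_val NormedPlane.continuous_of
  have key := norm_sub_eq_of_step (NormedPlane.finrank_eq (N := N) (hN := h0)) ?_ hdense
    (q := fun v : V => NormedPlane.of N h0 (f v)) (fun i j => by rw [hnorm, hnorm]; exact hf i j) u v
  · rwa [hnorm, hnorm] at key
  · rintro ⟨l₁, l₂, hl⟩
    apply hN
    have hinj : Function.Injective ((l₁.toLinearMap.prod l₂.toLinearMap) ∘ₗ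
        (NormedPlane.of N h0).toLinearMap) := by
      rw [injective_iff_map_eq_zero]
      intro x hx
      have hx' := Prod.ext_iff.1 hx
      have e1 : l₁ (NormedPlane.of N h0 x) = 0 := hx'.1
      have e2 : l₂ (NormedPlane.of N h0 x) = 0 := hx'.2
      apply h0
      rw [← NormedPlane.norm_of (hN := h0), hl, e1, e2]
      simp
    have hsurj := (LinearMap.injective_iff_surjective_of_finrank_eq_finrank (by simp)).1 hinj
    refine isParallelogram_iff_exists_linearEquiv.2
      ⟨(LinearEquiv.ofBijective _ ⟨hinj, hsurj⟩).symm, fun z => ?_⟩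
    obtain ⟨x, rfl⟩ := (LinearEquiv.ofBijective _ ⟨hinj, hsurj⟩).surjective z
    rw [LinearEquiv.symm_apply_apply, ← NormedPlane.norm_of (hN := h0), hl]
    rfl

theorem theorem1p2 (d : Plane → Plane → ℝ) (hd : d ∈ Omega) :
    HasTruncatingProperty d ↔ ¬ IsBoxMetric d := by
  have hnd : IsNormDerived d := by
    rcases hd with h | h
    · exact h.1
    · exact h.1
  obtain ⟨N, h0, hN⟩ := hnd
  have hshape : shape d = {x | N x ≤ 1} := by
    ext x
    simp [shape, hN]
  constructor
  · intro htr hbox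
    exact not_hasTruncatingProperty_of_isParallelogram hN (hshape ▸ hbox.2) htr
  · intro hbox
    refine hasTruncatingProperty_of_not_isParallelogram h0 hN fun h => hbox ⟨⟨N, h0, hN⟩, ?_⟩
    rwa [hshape]
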